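/- For a group $G$ write $x^y=y^{-1}xy$ and $[x,y]=x^{-1}y^{-1}xy$. Let $G\wedge G$ be the nonabelian exterior square of $G$, i.e. the group generated by the symbols $x\wedge y$ $(x,y\in G)$ subject to the relations $$xy\wedge z=(x^y\wedge z^y)(y\wedge z),\qquad x\wedge yz=(x\wedge z)(x^z\wedge y^z),\qquad x\wedge x=1\qquad(x,y,z\in G).$$ Put $M_0(G)=\langle x\wedge y : x,y\in G,\ [x,y]=1\rangle$, a normal subgroup of $G\wedge G$, and let $B_0(G)$ be the kernel of the commutator homomorphism $(G\wedge G)/M_0(G)\to[G,G]$ induced by $x\wedge y\mapsto[x,y]$ (the Bogomolov multiplier of $G$). A finite group $G$ is called $B_0$-minimal if $B_0(G)\neq 0$, while $B_0(H)=0$ for every proper subgroup $H$ of $G$ and $B_0(G/N)=0$ for every nontrivial normal subgroup $N$ of $G$. **Theorem 2.6.** Let $G$ be a $B_0$-minimal finite group. Then the Frattini subgroup of $G$ is abelian, and $G$ can be generated by at most $4$ elements. If moreover $G$ is nilpotent of class at least $3$, then $G$ can be generated by at most $3$ elements. -/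

import Mathlib

/-- Right conjugation `x ^ y = y⁻¹ x y`. -/
def rconj {G : Type*} [Group G] (x y : G) : G := y⁻¹ * x * y

/-- The commutator `[x, y] = x⁻¹ y⁻¹ x y = x⁻¹ x ^ y` of the right-conjugation convention. -/
def rcomm {G : Type*} [Group G] (x y : G) : G := x⁻¹ * y⁻¹ * x * y

/-- The defining relators of the nonabelian exterior square, in the free group on the symbols
`(x, y)`, which stand for `x ∧ y`:
`xy ∧ z = (x^y ∧ z^y)(y ∧ z)`, `x ∧ yz = (x ∧ z)(x^z ∧ y^z)`, `x ∧ x = 1`. -/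
def exteriorRels (G : Type*) [Group G] : Set (FreeGroup (G × G)) :=
  {r | (∃ x y z : G, r = FreeGroup.of (x * y, z) *
          (FreeGroup.of (rconj x y, rconj z y) * FreeGroup.of (y, z))⁻¹) ∨
       (∃ x y z : G, r = FreeGroup.of (x, y * z) *
          (FreeGroup.of (x, z) * FreeGroup.of (rconj x z, rconj y z))⁻¹) ∨
       (∃ x : G, r = FreeGroup.of (x, x))}

/-- The nonabelian exterior square `G ∧ G`. -/
abbrev ExteriorSquare (G : Type*) [Group G] : Type _ := PresentedGroup (exteriorRels G)

/-- The generator `x ∧ y` of `G ∧ G`. -/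
def wedge {G : Type*} [Group G] (x y : G) : ExteriorSquare G := PresentedGroup.of (x, y)

theorem wedge_mul_left {G : Type*} [Group G] (x y z : G) :
    wedge (x * y) z = wedge (rconj x y) (rconj z y) * wedge y z :=
  PresentedGroup.mk_eq_mk_of_mul_inv_mem (Or.inl ⟨x, y, z, rfl⟩)

theorem wedge_mul_right {G : Type*} [Group G] (x y z : G) :
    wedge x (y * z) = wedge x z * wedge (rconj x z) (rconj y z) :=
  PresentedGroup.mk_eq_mk_of_mul_inv_mem (Or.inr (Or.inl ⟨x, y, z, rfl⟩))

theorem wedge_self {G : Type*} [Group G] (x : G) : wedge x x = 1 :=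
  PresentedGroup.one_of_mem (Or.inr (Or.inr ⟨x, rfl⟩))

/-- The homomorphism `G ∧ G → G`, `x ∧ y ↦ [x, y]`, whose image is the derived subgroup. -/
def wedgeComm (G : Type*) [Group G] : ExteriorSquare G →* G :=
  PresentedGroup.toGroup (f := fun p : G × G => rcomm p.1 p.2) (by
    rintro r (⟨x, y, z, rfl⟩ | ⟨x, y, z, rfl⟩ | ⟨x, rfl⟩) <;>
      simp only [map_mul, map_inv, FreeGroup.lift_apply_of, rcomm, rconj] <;> group)

theorem wedgeComm_wedge {G : Type*} [Group G] (x y : G) :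
    wedgeComm G (wedge x y) = rcomm x y :=
  PresentedGroup.toGroup.of _

/-- The subgroup `M₀(G) = ⟨x ∧ y | x, y ∈ G, [x, y] = 1⟩` of `G ∧ G`. -/
def commutingWedges (G : Type*) [Group G] : Subgroup (ExteriorSquare G) :=
  Subgroup.closure {w | ∃ x y : G, rcomm x y = 1 ∧ w = wedge x y}

theorem wedge_conj {G : Type*} [Group G] (a b y w : G) :
    wedge a b * wedge y w =
      wedge y w * wedge (rconj a (rcomm y w)) (rconj b (rcomm y w)) := by
  have key : ∀ x z : G, wedge (rconj x (w * y)) (rconj z (w * y)) * wedge y w =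
      wedge y w * wedge (rconj x (y * w)) (rconj z (y * w)) := by
    intro x z
    have h1 : wedge (x * y) (z * w) = wedge (rconj x y) (rconj w y) *
        (wedge (rconj x (w * y)) (rconj z (w * y)) * wedge y w) *
          wedge (rconj y w) (rconj z w) := by
      have e : rconj (z * w) y = rconj z y * rconj w y := by simp only [rconj]; group
      rw [wedge_mul_left, e, wedge_mul_right, wedge_mul_right y z w]
      have e1 : rconj (rconj x y) (rconj w y) = rconj x (w * y) := by simp only [rconj]; group
      have e2 : rconj (rconj z y) (rconj w y) = rconj z (w * y) := by simp only [rconj]; group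
      rw [e1, e2]; simp only [mul_assoc]
    have h2 : wedge (x * y) (z * w) = wedge (rconj x y) (rconj w y) *
        (wedge y w * wedge (rconj x (y * w)) (rconj z (y * w))) *
          wedge (rconj y w) (rconj z w) := by
      have e : rconj (x * y) w = rconj x w * rconj y w := by simp only [rconj]; group
      rw [wedge_mul_right, e, wedge_mul_left, wedge_mul_left (rconj x w)]
      have e1 : rconj (rconj x w) (rconj y w) = rconj x (y * w) := by simp only [rconj]; group
      have e2 : rconj (rconj z w) (rconj y w) = rconj z (y * w) := by simp only [rconj]; group
      rw [e1, e2]; simp only [mul_assoc]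
    exact mul_left_cancel (mul_right_cancel (h1.symm.trans h2))
  have h := key (rconj a (w * y)⁻¹) (rconj b (w * y)⁻¹)
  have e1 : ∀ c : G, rconj (rconj c (w * y)⁻¹) (w * y) = c := by
    intro c; simp only [rconj]; group
  have e2 : ∀ c : G, rconj (rconj c (w * y)⁻¹) (y * w) = rconj c (rcomm y w) := by
    intro c; simp only [rconj, rcomm]; group
  rwa [e1, e1, e2, e2] at h

theorem rcomm_eq_one_iff {G : Type*} [Group G] (x y : G) : rcomm x y = 1 ↔ x * y = y * x := by
  have e : rcomm x y = (y * x)⁻¹ * (x * y) := by simp only [rcomm]; group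
  rw [e, inv_mul_eq_one, eq_comm]

instance commutingWedges_normal (G : Type*) [Group G] : (commutingWedges G).Normal := by
  -- A commuting generator `y ∧ w` centralizes every `a ∧ b`, hence is central.
  have hc : commutingWedges G ≤ Subgroup.center (ExteriorSquare G) := by
    rw [commutingWedges, Subgroup.closure_le]
    rintro _ ⟨y, w, h, rfl⟩
    rw [SetLike.mem_coe, Subgroup.mem_center_iff]
    intro g
    have hg : g ∈ Subgroup.closure (Set.range (PresentedGroup.of (rels := exteriorRels G))) := by
      rw [PresentedGroup.closure_range_of]; trivial
    induction hg using Subgroup.closure_induction with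
    | mem g hg =>
      obtain ⟨⟨a, b⟩, rfl⟩ := hg
      have := wedge_conj a b y w
      rw [h] at this
      have e : ∀ c : G, rconj c 1 = c := fun c => by simp [rconj]
      rw [e, e] at this
      exact this
    | one => simp
    | mul u v _ _ hu hv => rw [mul_assoc, hv, ← mul_assoc, hu, mul_assoc]
    | inv u _ hu => exact (Commute.inv_left (show Commute u _ from hu))
  refine ⟨fun n hn g => ?_⟩
  have := Subgroup.mem_center_iff.mp (hc hn) g
  rwa [this, mul_inv_cancel_right]

/-- The group `G ⋏ G = (G ∧ G) / M₀(G)`. -/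
abbrev CurlyWedge (G : Type*) [Group G] : Type _ := ExteriorSquare G ⧸ commutingWedges G

/-- The commutator map `G ⋏ G → G`, whose image is the derived subgroup. -/
def curlyComm (G : Type*) [Group G] : CurlyWedge G →* G :=
  QuotientGroup.lift (commutingWedges G) (wedgeComm G) (by
    intro w hw
    have : commutingWedges G ≤ (wedgeComm G).ker := by
      rw [commutingWedges, Subgroup.closure_le]
      rintro _ ⟨x, y, h, rfl⟩
      exact (wedgeComm_wedge x y).trans h
    exact this hw)

/-- The Bogomolov multiplier `B₀(G)`, the kernel of the commutator map `G ⋏ G → [G, G]`; this is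
the image of `M(G) = ker (G ∧ G → [G, G])` in `G ⋏ G`, that is, `M(G) / M₀(G)`. -/
def bogomolovMultiplier (G : Type*) [Group G] : Subgroup (CurlyWedge G) := (curlyComm G).ker

/-- A finite group `G` is `B₀`-minimal if `B₀(G) ≠ 0`, while `B₀(H) = 0` for every proper subgroup
`H` and `B₀(G ⧸ N) = 0` for every nontrivial normal subgroup `N` (so that `G ⧸ N` is a proper
quotient). -/
structure IsB0Minimal (G : Type*) [Group G] [Finite G] : Prop where
  ne_bot : bogomolovMultiplier G ≠ ⊥
  subgroup : ∀ H : Subgroup G, H ≠ ⊤ → bogomolovMultiplier H = ⊥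
  quotient : ∀ (N : Subgroup G) [N.Normal], N ≠ ⊥ → bogomolovMultiplier (G ⧸ N) = ⊥

/-! Write ∂ for the commutator map from G ⋏ G to G. If B₀(H) = 0, an element of the image of H ⋏ H
in G ⋏ G is determined by its value under ∂. Minimality makes this available for every proper
subgroup H.

The core is `IsB0Minimal.exists_sup_closure_eq_top`: if z ≠ 1 is central and lies in [S, S], then
some a, b with [a, b] ∈ ⟨z⟩ satisfy ⟨S, a, b⟩ = G. Otherwise choose t in the image of S ⋏ S with ∂t
= z. Whenever [a, b] = z^k, the subgroup ⟨S, a, b⟩ is proper, so a ⋏ b = t^k. Since B₀(G/⟨z⟩) = 0,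
B₀(G) lies in the subgroup generated by such a ⋏ b, hence in ⟨t⟩, hence in the image of S ⋏ S; as
B₀(S) = 0, it is trivial.

To find central elements one needs G to be a p-group. If it is not, a Sylow p-subgroup P is proper
and every w ∈ B₀(G) is killed by an integer prime to p: by [G : P] through a transfer argument when
G'P = G, and otherwise by the index of a maximal subgroup K ≥ G'P, where G/K is cyclic. If this
happened for all p, B₀(G) would vanish.

With S the Frattini subgroup Φ, assumed nonabelian, the core lemma gives G = ⟨a, b⟩ with G' inside a
central subgroup of order p, so Φ is central after all. With S = ⟨x, y⟩, where [x, y] ≠ 1 is central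
and x lies in the next-to-last nontrivial term of the lower central series, it gives four
generators; in class at least 3, x ∈ G' ≤ Φ is superfluous. -/

/-! ### The group G ⋏ G as a crossed module over G -/

section CurlyWedgeBasics

variable {G : Type*} [Group G] {L : Type*} [Group L]

/-- The image of `x ∧ y` in `G ⋏ G`. -/
def curlyWedge (x y : G) : CurlyWedge G := QuotientGroup.mk (wedge x y)

theorem curlyWedge_mul_left (x y z : G) :
    curlyWedge (x * y) z = curlyWedge (rconj x y) (rconj z y) * curlyWedge y z := by
  simp only [curlyWedge, wedge_mul_left, QuotientGroup.mk_mul]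

theorem curlyWedge_mul_right (x y z : G) :
    curlyWedge x (y * z) = curlyWedge x z * curlyWedge (rconj x z) (rconj y z) := by
  simp only [curlyWedge, wedge_mul_right, QuotientGroup.mk_mul]

theorem curlyWedge_eq_one {x y : G} (h : rcomm x y = 1) : curlyWedge x y = 1 :=
  (QuotientGroup.eq_one_iff _).2 (Subgroup.subset_closure ⟨x, y, h, rfl⟩)

theorem curlyWedge_self (x : G) : curlyWedge x x = 1 :=
  curlyWedge_eq_one (by simp [rcomm])

theorem curlyWedge_one_left (x : G) : curlyWedge 1 x = 1 :=
  curlyWedge_eq_one (by simp [rcomm])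

theorem curlyWedge_one_right (x : G) : curlyWedge x 1 = 1 :=
  curlyWedge_eq_one (by simp [rcomm])

theorem curlyComm_curlyWedge (x y : G) : curlyComm G (curlyWedge x y) = rcomm x y :=
  wedgeComm_wedge x y

theorem closure_curlyWedge :
    Subgroup.closure {t : CurlyWedge G | ∃ x y, t = curlyWedge x y} = ⊤ := by
  rw [eq_top_iff]
  rintro t -
  obtain ⟨s, rfl⟩ := QuotientGroup.mk_surjective t
  have hs : s ∈ Subgroup.closure (Set.range (PresentedGroup.of (rels := exteriorRels G))) := by
    rw [PresentedGroup.closure_range_of]; trivial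
  induction hs using Subgroup.closure_induction with
  | mem s hs =>
    obtain ⟨⟨x, y⟩, rfl⟩ := hs
    exact Subgroup.subset_closure ⟨x, y, rfl⟩
  | one => exact one_mem _
  | mul u v _ _ hu hv => exact mul_mem hu hv
  | inv u _ hu => exact inv_mem hu

theorem mem_of_curlyWedge_mem {S : Subgroup (CurlyWedge G)} (h : ∀ x y, curlyWedge x y ∈ S)
    (t : CurlyWedge G) : t ∈ S := by
  have : (⊤ : Subgroup (CurlyWedge G)) ≤ S := by
    rw [← closure_curlyWedge, Subgroup.closure_le]
    rintro _ ⟨x, y, rfl⟩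
    exact h x y
  exact this trivial

theorem curlyWedge_hom_ext {f g : CurlyWedge G →* L}
    (h : ∀ x y, f (curlyWedge x y) = g (curlyWedge x y)) : f = g :=
  MonoidHom.ext fun t => mem_of_curlyWedge_mem (S := f.eqLocus g) h t

/-- The universal property of `G ⋏ G`. -/
def curlyLift (β : G → G → L)
    (hl : ∀ x y z, β (x * y) z = β (rconj x y) (rconj z y) * β y z)
    (hr : ∀ x y z, β x (y * z) = β x z * β (rconj x z) (rconj y z))
    (hc : ∀ x y, rcomm x y = 1 → β x y = 1) : CurlyWedge G →* L :=
  QuotientGroup.lift (commutingWedges G)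
    (PresentedGroup.toGroup (f := fun p : G × G => β p.1 p.2) (by
      rintro r (⟨x, y, z, rfl⟩ | ⟨x, y, z, rfl⟩ | ⟨x, rfl⟩)
      · simp only [map_mul, map_inv, FreeGroup.lift_apply_of, hl x y z, mul_inv_cancel]
      · simp only [map_mul, map_inv, FreeGroup.lift_apply_of, hr x y z, mul_inv_cancel]
      · simpa only [FreeGroup.lift_apply_of] using hc x x (by simp [rcomm])))
    (by
      intro w hw
      refine (Subgroup.closure_le (MonoidHom.ker _)).2 ?_ hw
      rintro _ ⟨x, y, h, rfl⟩
      exact (PresentedGroup.toGroup.of _).trans (hc x y h))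

theorem curlyLift_curlyWedge (β : G → G → L) (hl hr hc) (x y : G) :
    curlyLift β hl hr hc (curlyWedge x y) = β x y := by
  rw [curlyLift, curlyWedge, QuotientGroup.lift_mk, wedge, PresentedGroup.toGroup.of]

theorem map_rconj (f : G →* L) (x y : G) : f (rconj x y) = rconj (f x) (f y) := by
  simp [rconj]

theorem map_rcomm (f : G →* L) (x y : G) : f (rcomm x y) = rcomm (f x) (f y) := by
  simp [rcomm]

/-- Functoriality of `G ⋏ G`. -/
def curlyMap (f : G →* L) : CurlyWedge G →* CurlyWedge L :=
  curlyLift (fun x y => curlyWedge (f x) (f y))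
    (fun x y z => by simp only [map_mul, map_rconj, curlyWedge_mul_left])
    (fun x y z => by simp only [map_mul, map_rconj, curlyWedge_mul_right])
    (fun x y h => curlyWedge_eq_one (by rw [← map_rcomm, h, map_one]))

@[simp]
theorem curlyMap_curlyWedge (f : G →* L) (x y : G) :
    curlyMap f (curlyWedge x y) = curlyWedge (f x) (f y) :=
  curlyLift_curlyWedge _ _ _ _ x y

theorem curlyComm_curlyMap (f : G →* L) (t : CurlyWedge G) :
    curlyComm L (curlyMap f t) = f (curlyComm G t) := by
  have : (curlyComm L).comp (curlyMap f) = f.comp (curlyComm G) :=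
    curlyWedge_hom_ext fun x y => by
      simp [curlyComm_curlyWedge, map_rcomm]
  exact DFunLike.congr_fun this t

/-- The conjugation action of `G` on `G ⋏ G`. -/
def curlyConj (g : G) : CurlyWedge G →* CurlyWedge G := curlyMap (MulAut.conj g).toMonoidHom

theorem curlyConj_curlyWedge (g x y : G) :
    curlyConj g (curlyWedge x y) = curlyWedge (g * x * g⁻¹) (g * y * g⁻¹) := by
  simp [curlyConj]

theorem curlyConj_inv_curlyWedge (g x y : G) :
    curlyConj g⁻¹ (curlyWedge x y) = curlyWedge (rconj x g) (rconj y g) := by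
  simp [curlyConj, rconj]

theorem curlyConj_mul (g h : G) (t : CurlyWedge G) :
    curlyConj (g * h) t = curlyConj g (curlyConj h t) := by
  have : curlyConj (g * h) = (curlyConj g).comp (curlyConj h) :=
    curlyWedge_hom_ext fun x y => by
      simp only [MonoidHom.comp_apply, curlyConj_curlyWedge]
      congr 1 <;> group
  exact DFunLike.congr_fun this t

@[simp]
theorem curlyConj_one (t : CurlyWedge G) : curlyConj 1 t = t := by
  have : curlyConj (1 : G) = MonoidHom.id _ :=
    curlyWedge_hom_ext fun x y => by simp [curlyConj_curlyWedge]
  exact DFunLike.congr_fun this t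

theorem curlyComm_curlyConj (g : G) (t : CurlyWedge G) :
    curlyComm G (curlyConj g t) = g * curlyComm G t * g⁻¹ := by
  simp [curlyConj, curlyComm_curlyMap]

theorem curlyWedge_mul_left' (x y z : G) :
    curlyWedge (x * y) z = curlyConj y⁻¹ (curlyWedge x z) * curlyWedge y z := by
  rw [curlyConj_inv_curlyWedge, curlyWedge_mul_left]

theorem curlyWedge_mul_right' (x y z : G) :
    curlyWedge x (y * z) = curlyWedge x z * curlyConj z⁻¹ (curlyWedge x y) := by
  rw [curlyConj_inv_curlyWedge, curlyWedge_mul_right]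

/-- The Peiffer identity. -/
theorem curlyConj_curlyComm (s t : CurlyWedge G) :
    curlyConj (curlyComm G s) t = s * t * s⁻¹ := by
  let S : Subgroup (CurlyWedge G) :=
    { carrier := {s | ∀ t, curlyConj (curlyComm G s) t = s * t * s⁻¹}
      one_mem' := fun t => by simp
      mul_mem' := fun {a b} ha hb t => by
        rw [map_mul, curlyConj_mul, hb, ha]; group
      inv_mem' := fun {a} ha t => by
        have h := ha (curlyConj (curlyComm G a)⁻¹ t)
        rw [← curlyConj_mul, mul_inv_cancel, curlyConj_one] at h
        rw [map_inv]
        conv_rhs => rw [h]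
        simp [mul_assoc] }
  refine mem_of_curlyWedge_mem (S := S) (fun x y => ?_) s t
  -- `wedge_conj` describes conjugation by the inverse of a generator, because `rconj` is a right
  -- action.
  rw [← inv_inv (curlyWedge x y)]
  refine S.inv_mem fun t => ?_
  have : curlyConj (curlyComm G (curlyWedge x y)⁻¹) =
      (MulAut.conj (curlyWedge x y)⁻¹).toMonoidHom := curlyWedge_hom_ext fun a b => by
    have h := congrArg (QuotientGroup.mk (s := commutingWedges G)) (wedge_conj a b x y)
    simp only [QuotientGroup.mk_mul] at h
    change curlyWedge a b * curlyWedge x y = curlyWedge x y * curlyWedge _ _ at h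
    rw [map_inv, curlyComm_curlyWedge, curlyConj_inv_curlyWedge]
    simp only [MulEquiv.toMonoidHom_eq_coe, MonoidHom.coe_coe, MulAut.conj_apply, inv_inv]
    rw [mul_assoc, h, inv_mul_cancel_left]
  rw [this]
  simp

/-- By the Peiffer identity the elements t with this property form a subgroup, so generators
suffice. The formula expresses the difference between t and a conjugate as a single wedge; the later
congruences rest on it. -/
theorem curlyConj_inv_eq_mul (g : G) (t : CurlyWedge G) :
    curlyConj g⁻¹ t = t * curlyWedge (curlyComm G t) g := by
  let S : Subgroup (CurlyWedge G) :=
    { carrier := {t | curlyConj g⁻¹ t = t * curlyWedge (curlyComm G t) g}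
      one_mem' := by simp [curlyWedge_one_left]
      mul_mem' := fun {a b} ha hb => by
        simp only [Set.mem_ofPred_eq] at *
        rw [map_mul, map_mul, ha, hb, curlyWedge_mul_left', ← map_inv, curlyConj_curlyComm]
        group
      inv_mem' := fun {a} ha => by
        simp only [Set.mem_ofPred_eq] at *
        have h : curlyWedge ((curlyComm G a)⁻¹ * curlyComm G a) g = 1 := by
          rw [inv_mul_cancel, curlyWedge_one_left]
        rw [curlyWedge_mul_left', ← map_inv, curlyConj_curlyComm, ← eq_inv_iff_mul_eq_one] at h
        rw [map_inv, ha, mul_inv_rev, ← h]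
        group }
  refine mem_of_curlyWedge_mem (S := S) (fun x y => ?_) t
  change curlyConj g⁻¹ (curlyWedge x y) =
    curlyWedge x y * curlyWedge (curlyComm G (curlyWedge x y)) g
  -- Expand `y x ∧ y g` in two ways.
  have key : curlyWedge x y * curlyConj y⁻¹ (curlyWedge x g) * curlyWedge y g =
      curlyConj x⁻¹ (curlyWedge y g) * curlyWedge x g * curlyConj g⁻¹ (curlyWedge x y) := by
    have h1 : curlyWedge (y * x) (y * g) =
        curlyConj x⁻¹ (curlyWedge y g) * curlyWedge x g * curlyConj g⁻¹ (curlyWedge x y) := by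
      rw [curlyWedge_mul_left', curlyWedge_mul_right', curlyWedge_mul_right' x, curlyWedge_self,
        map_one, mul_one, mul_assoc]
    have h2 : curlyWedge (y * x) (y * g) =
        curlyWedge x y * curlyConj y⁻¹ (curlyWedge x g) * curlyWedge y g := by
      have e : y * x = y * x * y⁻¹ * y := by group
      rw [e, curlyWedge_mul_left', curlyWedge_mul_right' y, curlyWedge_self, map_one, mul_one,
        ← curlyWedge_mul_right', curlyConj_inv_curlyWedge]
      congr 2 <;> (simp only [rconj]; group)
    exact h2.symm.trans h1
  have hxy : curlyWedge (x * y) g = curlyWedge (y * x * rcomm x y) g := by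
    congr 1; simp only [rcomm]; group
  rw [curlyWedge_mul_left', curlyWedge_mul_left' (y * x), curlyWedge_mul_left' y,
    ← curlyComm_curlyWedge, ← map_inv, curlyConj_curlyComm] at hxy
  have h3 : curlyWedge x y * (curlyConj y⁻¹ (curlyWedge x g) * curlyWedge y g) =
    curlyConj x⁻¹ (curlyWedge y g) * curlyWedge x g *
      (curlyWedge x y * curlyWedge (curlyComm G (curlyWedge x y)) g) := by
    rw [hxy]; group
  rw [← mul_assoc, key] at h3
  exact mul_left_cancel h3

/-- The correction factor ∂t ⋏ g is 1 ⋏ g = 1. With the Peiffer identity this also makes B₀(G)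
central. -/
theorem curlyConj_eq_self {t : CurlyWedge G} (ht : t ∈ bogomolovMultiplier G) (g : G) :
    curlyConj g t = t := by
  have h := curlyConj_inv_eq_mul g⁻¹ t
  rwa [inv_inv, show curlyComm G t = 1 from ht, curlyWedge_one_left, mul_one] at h

theorem mul_comm_of_mem_bogomolovMultiplier {t : CurlyWedge G} (ht : t ∈ bogomolovMultiplier G)
    (s : CurlyWedge G) : s * t = t * s := by
  have h := curlyConj_curlyComm s t
  rw [curlyConj_eq_self ht] at h
  rw [eq_mul_inv_iff_mul_eq] at h
  exact h.symm

/-- Expand xy ⋏ xy = 1. -/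
theorem curlyWedge_inv (x y : G) : (curlyWedge x y)⁻¹ = curlyWedge y x := by
  have h := curlyWedge_self (x * y)
  rw [curlyWedge_mul_left', curlyWedge_mul_right', curlyWedge_mul_right', curlyWedge_self,
    curlyWedge_self, map_one, mul_one, one_mul, ← map_mul] at h
  replace h := congrArg (curlyConj y) h
  rw [← curlyConj_mul, mul_inv_cancel, curlyConj_one, map_one] at h
  exact inv_eq_of_mul_eq_one_right h

/-- The image of `H ⋏ H` in `G ⋏ G`. -/
def curlyRange (H : Subgroup G) : Subgroup (CurlyWedge G) := (curlyMap H.subtype).range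

theorem curlyWedge_mem_curlyRange {H : Subgroup G} {x y : G} (hx : x ∈ H) (hy : y ∈ H) :
    curlyWedge x y ∈ curlyRange H :=
  ⟨curlyWedge ⟨x, hx⟩ ⟨y, hy⟩, by simp⟩

theorem curlyRange_le {H : Subgroup G} {S : Subgroup (CurlyWedge G)}
    (h : ∀ x ∈ H, ∀ y ∈ H, curlyWedge x y ∈ S) : curlyRange H ≤ S := by
  rintro _ ⟨t, rfl⟩
  exact mem_of_curlyWedge_mem (S := S.comap (curlyMap H.subtype))
    (fun x y => by simpa using h x x.2 y y.2) t

theorem curlyRange_mono {H K : Subgroup G} (h : H ≤ K) : curlyRange H ≤ curlyRange K :=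
  curlyRange_le fun _ hx _ hy => curlyWedge_mem_curlyRange (h hx) (h hy)

theorem eq_one_of_mem_curlyRange {H : Subgroup G} (hH : bogomolovMultiplier H = ⊥)
    {t : CurlyWedge G} (ht : t ∈ curlyRange H) (h1 : curlyComm G t = 1) : t = 1 := by
  obtain ⟨s, rfl⟩ := ht
  rw [curlyComm_curlyMap] at h1
  have hs : s ∈ bogomolovMultiplier H := Subtype.ext h1
  rw [hH, Subgroup.mem_bot] at hs
  rw [hs, map_one]

theorem eq_of_mem_curlyRange {H : Subgroup G} (hH : bogomolovMultiplier H = ⊥)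
    {s t : CurlyWedge G} (hs : s ∈ curlyRange H) (ht : t ∈ curlyRange H)
    (h : curlyComm G s = curlyComm G t) : s = t := by
  rw [← mul_inv_eq_one]
  exact eq_one_of_mem_curlyRange hH (mul_mem hs (inv_mem ht)) (by simp [h])

theorem curlyConj_mem_curlyRange {H : Subgroup G} {g : G}
    (hg : ∀ x ∈ H, g * x * g⁻¹ ∈ H) {t : CurlyWedge G} (ht : t ∈ curlyRange H) :
    curlyConj g t ∈ curlyRange H := by
  refine curlyRange_le (S := (curlyRange H).comap (curlyConj g)) (fun x hx y hy => ?_) ht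
  rw [Subgroup.mem_comap, curlyConj_curlyWedge]
  exact curlyWedge_mem_curlyRange (hg x hx) (hg y hy)

end CurlyWedgeBasics

/-! ### The kernel of G ⋏ G → G/N ⋏ G/N -/

section KernelOfQuotientMap

variable {G : Type*} [Group G]

/-- The subgroup of `G ⋏ G` generated by the `x ⋏ y` with `[x, y] ∈ N`. -/
def curlyWedgeMod (N : Subgroup G) : Subgroup (CurlyWedge G) :=
  Subgroup.closure {t | ∃ x y, rcomm x y ∈ N ∧ t = curlyWedge x y}

theorem curlyWedge_mem_curlyWedgeMod {N : Subgroup G} {x y : G} (h : rcomm x y ∈ N) :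
    curlyWedge x y ∈ curlyWedgeMod N :=
  Subgroup.subset_closure ⟨x, y, h, rfl⟩

instance curlyWedgeMod_normal (N : Subgroup G) [hN : N.Normal] : (curlyWedgeMod N).Normal := by
  refine ⟨fun t ht s => ?_⟩
  rw [← curlyConj_curlyComm]
  generalize curlyComm G s = g
  refine (Subgroup.closure_le ((curlyWedgeMod N).comap (curlyConj g))).2 ?_ ht
  rintro _ ⟨x, y, h, rfl⟩
  refine curlyWedge_mem_curlyWedgeMod (x := MulAut.conj g x) (y := MulAut.conj g y) ?_
  have e := map_rcomm (MulAut.conj g).toMonoidHom x y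
  simp only [MulEquiv.toMonoidHom_eq_coe, MonoidHom.coe_coe] at e
  rw [← e]
  exact hN.conj_mem _ h g

theorem rcomm_mem_of_left {N : Subgroup G} [hN : N.Normal] {n : G} (hn : n ∈ N) (x : G) :
    rcomm n x ∈ N := by
  have h := N.mul_mem (N.inv_mem hn) (hN.conj_mem n hn x⁻¹)
  rwa [inv_inv, ← mul_assoc, ← mul_assoc] at h

theorem rcomm_mem_of_right {N : Subgroup G} [hN : N.Normal] {n : G} (hn : n ∈ N) (x : G) :
    rcomm x n ∈ N := by
  have h := N.mul_mem (hN.conj_mem _ (N.inv_mem hn) x⁻¹) hn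
  rwa [inv_inv] at h

/-- Expanding the products leaves x ⋏ y times wedges having an entry in N, whose commutators
therefore lie in N. -/
theorem mk_curlyWedge_mul_mul (N : Subgroup G) [N.Normal] (x y : G) {m n : G} (hm : m ∈ N)
    (hn : n ∈ N) :
    (QuotientGroup.mk (curlyWedge (x * m) (y * n)) : CurlyWedge G ⧸ curlyWedgeMod N) =
      QuotientGroup.mk (curlyWedge x y) := by
  have hl : ∀ z, (QuotientGroup.mk (curlyWedge (x * m) z) : CurlyWedge G ⧸ curlyWedgeMod N) =
      QuotientGroup.mk (curlyWedge x z) := fun z => by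
    rw [curlyWedge_mul_left', curlyConj_inv_eq_mul, mul_assoc]
    exact QuotientGroup.mk_mul_of_mem _ (mul_mem
      (curlyWedge_mem_curlyWedgeMod (rcomm_mem_of_right hm _))
      (curlyWedge_mem_curlyWedgeMod (rcomm_mem_of_left hm _)))
  rw [hl, curlyWedge_mul_right', curlyConj_inv_eq_mul, QuotientGroup.mk_mul,
    (QuotientGroup.eq_one_iff _).2 (curlyWedge_mem_curlyWedgeMod (rcomm_mem_of_right hn _)),
    one_mul]
  exact QuotientGroup.mk_mul_of_mem _ (curlyWedge_mem_curlyWedgeMod (rcomm_mem_of_right hn _))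

theorem mk_curlyWedge_congr (N : Subgroup G) [N.Normal] {x y x' y' : G}
    (hx : (x : G ⧸ N) = x') (hy : (y : G ⧸ N) = y') :
    (QuotientGroup.mk (curlyWedge x y) : CurlyWedge G ⧸ curlyWedgeMod N) =
      QuotientGroup.mk (curlyWedge x' y') := by
  rw [← mk_curlyWedge_mul_mul N x y (QuotientGroup.eq.1 hx) (QuotientGroup.eq.1 hy),
    mul_inv_cancel_left, mul_inv_cancel_left]

/-- The kernel of `G ⋏ G → G/N ⋏ G/N` lies in the subgroup generated by the `x ⋏ y` with
`[x, y] ∈ N`. -/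
theorem ker_curlyMap_mk_le (N : Subgroup G) [N.Normal] :
    (curlyMap (QuotientGroup.mk' N)).ker ≤ curlyWedgeMod N := by
  -- The projection onto the quotient by `curlyWedgeMod N` factors through G/N ⋏ G/N: wedges of
  -- coset representatives do not depend on the choice and satisfy the defining relations.
  let β : G ⧸ N → G ⧸ N → CurlyWedge G ⧸ curlyWedgeMod N :=
    fun a b => QuotientGroup.mk (curlyWedge a.out b.out)
  have hβ : ∀ x y : G, β x y = QuotientGroup.mk (curlyWedge x y) := fun x y =>
    mk_curlyWedge_congr N (QuotientGroup.out_eq' _) (QuotientGroup.out_eq' _)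
  let f : CurlyWedge (G ⧸ N) →* CurlyWedge G ⧸ curlyWedgeMod N := curlyLift β
    (by
      rintro ⟨x⟩ ⟨y⟩ ⟨z⟩
      exact (hβ (x * y) z).trans ((congrArg QuotientGroup.mk (curlyWedge_mul_left x y z)).trans
        (congrArg₂ (· * ·) (hβ (rconj x y) (rconj z y)) (hβ y z)).symm))
    (by
      rintro ⟨x⟩ ⟨y⟩ ⟨z⟩
      exact (hβ x (y * z)).trans ((congrArg QuotientGroup.mk (curlyWedge_mul_right x y z)).trans
        (congrArg₂ (· * ·) (hβ x z) (hβ (rconj x z) (rconj y z))).symm))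
    (by
      rintro ⟨x⟩ ⟨y⟩ h
      refine (hβ x y).trans ((QuotientGroup.eq_one_iff _).2 (curlyWedge_mem_curlyWedgeMod ?_))
      rw [← QuotientGroup.eq_one_iff]
      exact h)
  have hf : f.comp (curlyMap (QuotientGroup.mk' N)) = QuotientGroup.mk' (curlyWedgeMod N) :=
    curlyWedge_hom_ext fun x y => by
      rw [MonoidHom.comp_apply, curlyMap_curlyWedge]
      exact (curlyLift_curlyWedge _ _ _ _ _ _).trans (hβ x y)
  intro t ht
  have h := DFunLike.congr_fun hf t
  rw [MonoidHom.comp_apply, ht, map_one] at h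
  exact (QuotientGroup.eq_one_iff t).1 h.symm

theorem mem_curlyWedgeMod_of_mem_bogomolovMultiplier {N : Subgroup G} [N.Normal]
    (hN : bogomolovMultiplier (G ⧸ N) = ⊥) {t : CurlyWedge G} (ht : t ∈ bogomolovMultiplier G) :
    t ∈ curlyWedgeMod N := by
  refine ker_curlyMap_mk_le N ?_
  have : curlyMap (QuotientGroup.mk' N) t ∈ bogomolovMultiplier (G ⧸ N) := by
    change curlyComm _ _ = 1
    rw [curlyComm_curlyMap, show curlyComm G t = 1 from ht, map_one]
  rwa [hN] at this

theorem commutator_le_map_curlyRange (S : Subgroup G) :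
    ⁅S, S⁆ ≤ (curlyRange S).map (curlyComm G) := by
  refine Subgroup.commutator_le.2 fun x hx y hy =>
    ⟨curlyWedge x⁻¹ y⁻¹, curlyWedge_mem_curlyRange (inv_mem hx) (inv_mem hy), ?_⟩
  rw [curlyComm_curlyWedge, rcomm, inv_inv, inv_inv, commutatorElement_def]

end KernelOfQuotientMap

/-! ### The core lemma on central commutators -/

section MinimalGroups

variable {G : Type*} [Group G] [Finite G]

theorem IsB0Minimal.exists_sup_closure_eq_top (hG : IsB0Minimal G) {S : Subgroup G} {z : G}
    (hz : z ∈ Subgroup.center G) (hz1 : z ≠ 1) (hzS : z ∈ ⁅S, S⁆) :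
    ∃ a b, rcomm a b ∈ Subgroup.zpowers z ∧ S ⊔ Subgroup.closure {a, b} = ⊤ := by
  by_contra! hne
  obtain ⟨t, ht, rfl⟩ := commutator_le_map_curlyRange S hzS
  set z := curlyComm G t with hzt
  -- The pair a = b = 1 shows that S itself is proper.
  have hS : S ≠ ⊤ := by
    have := hne 1 1 (by simp [rcomm, one_mem])
    simpa using this
  have hN : (Subgroup.zpowers z).Normal :=
    ⟨fun n hn g => by
      have hn' : n ∈ Subgroup.center G := (Subgroup.zpowers_le.2 hz) hn
      rwa [Subgroup.mem_center_iff.1 hn' g, mul_inv_cancel_right]⟩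
  have hle : curlyWedgeMod (Subgroup.zpowers z) ≤ Subgroup.zpowers t := by
    rw [curlyWedgeMod, Subgroup.closure_le]
    rintro _ ⟨a, b, hab, rfl⟩
    obtain ⟨k, hk⟩ := Subgroup.mem_zpowers_iff.1 hab
    refine Subgroup.mem_zpowers_iff.2 ⟨k, ?_⟩
    have hc : Subgroup.closure {a, b} ≤ S ⊔ Subgroup.closure {a, b} := le_sup_right
    refine eq_of_mem_curlyRange (hG.subgroup _ (hne a b hab))
      (zpow_mem (curlyRange_mono le_sup_left ht) k)
      (curlyWedge_mem_curlyRange (hc (Subgroup.subset_closure (by simp)))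
        (hc (Subgroup.subset_closure (by simp)))) ?_
    rw [map_zpow, curlyComm_curlyWedge, hk]
  refine hG.ne_bot (eq_bot_iff.2 fun w hw => ?_)
  obtain ⟨k, rfl⟩ := Subgroup.mem_zpowers_iff.1 (hle
    (mem_curlyWedgeMod_of_mem_bogomolovMultiplier
      (hG.quotient (Subgroup.zpowers z) (by simpa using hz1)) hw))
  exact eq_one_of_mem_curlyRange (hG.subgroup S hS) (zpow_mem ht k) hw

end MinimalGroups

/-! ### Generation of G ⋏ G and the image of K ⋏ K -/

section Generation

variable {G : Type*} [Group G]

theorem curlyComm_mem_commutator (t : CurlyWedge G) : curlyComm G t ∈ commutator G := by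
  refine mem_of_curlyWedge_mem (S := (commutator G).comap (curlyComm G)) (fun x y => ?_) t
  rw [Subgroup.mem_comap, curlyComm_curlyWedge, rcomm]
  have h := Subgroup.commutator_mem_commutator (H₁ := (⊤ : Subgroup G)) (H₂ := ⊤)
    (Subgroup.mem_top x⁻¹) (Subgroup.mem_top y⁻¹)
  rwa [commutatorElement_def, inv_inv, inv_inv] at h

theorem exists_curlyComm_eq {x : G} (hx : x ∈ commutator G) : ∃ t, curlyComm G t = x := by
  obtain ⟨t, -, ht⟩ := commutator_le_map_curlyRange ⊤ hx
  exact ⟨t, ht⟩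

/-- A `G`-invariant subgroup of `G ⋏ G` that contains `x ⋏ y` for all `x`, `y` in a generating
set of `G` is everything. -/
theorem mem_of_curlyConj_invariant {S : Subgroup (CurlyWedge G)}
    (hS : ∀ g, ∀ t ∈ S, curlyConj g t ∈ S) {X : Set G} (hX : Subgroup.closure X = ⊤)
    (h : ∀ x ∈ X, ∀ y ∈ X, curlyWedge x y ∈ S) (t : CurlyWedge G) : t ∈ S := by
  have extend : ∀ y, (∀ x ∈ X, curlyWedge x y ∈ S) → ∀ x, curlyWedge x y ∈ S := by
    intro y hy x
    have hx : x ∈ Subgroup.closure X := hX ▸ Subgroup.mem_top x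
    induction hx using Subgroup.closure_induction with
    | mem x hx => exact hy x hx
    | one => rw [curlyWedge_one_left]; exact one_mem S
    | mul a b _ _ ha hb =>
      rw [curlyWedge_mul_left']
      exact mul_mem (hS _ _ ha) hb
    | inv a _ ha =>
      have h1 := curlyWedge_mul_left' a a⁻¹ y
      rw [mul_inv_cancel, curlyWedge_one_left] at h1
      rw [← inv_eq_of_mul_eq_one_right h1.symm]
      exact inv_mem (hS _ _ ha)
  refine mem_of_curlyWedge_mem (fun x y => extend y (fun x hx => ?_) x) t
  rw [← curlyWedge_inv]
  exact inv_mem (extend x (fun y hy => h y hy x hx) y)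

theorem curlyConj_mem_curlyRange_of_normal {K : Subgroup G} [hK : K.Normal] (g : G)
    {t : CurlyWedge G} (ht : t ∈ curlyRange K) : curlyConj g t ∈ curlyRange K :=
  curlyConj_mem_curlyRange (fun x hx => hK.conj_mem x hx g) ht

instance curlyRange_normal (K : Subgroup G) [K.Normal] : (curlyRange K).Normal :=
  ⟨fun t ht s => by
    rw [← curlyConj_curlyComm]
    exact curlyConj_mem_curlyRange_of_normal _ ht⟩

/-- The quotient equals ∂t ⋏ k⁻¹. Thus K acts trivially, modulo the image of K ⋏ K, on the elements
t with ∂t ∈ K. -/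
theorem inv_mul_curlyConj_mem_curlyRange {K : Subgroup G} {t : CurlyWedge G}
    (ht : curlyComm G t ∈ K) {k : G} (hk : k ∈ K) : t⁻¹ * curlyConj k t ∈ curlyRange K := by
  have h := curlyConj_inv_eq_mul k⁻¹ t
  rw [inv_inv] at h
  rw [h, inv_mul_cancel_left]
  exact curlyWedge_mem_curlyRange ht (inv_mem hk)

end Generation

/-! ### Cyclic quotients -/

section CyclicQuotient

variable {G : Type*} [Group G] {K : Subgroup G} [hKn : K.Normal] {g : G}

/-- If `G/K` is cyclic, generated by `g`, then every element of `G ⋏ G` is congruent to some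
`g ⋏ k`, `k ∈ K`, modulo the image of `K ⋏ K`. -/
theorem exists_eq_curlyWedge_mul (hK : commutator G ≤ K) (hg : K ⊔ Subgroup.zpowers g = ⊤)
    (t : CurlyWedge G) : ∃ k ∈ K, ∃ s ∈ curlyRange K, t = curlyWedge g k * s := by
  -- Modulo the image of K ⋏ K, the map k ↦ g ⋏ k reverses products; this makes S below a subgroup.
  have hmul : ∀ k ∈ K, ∀ l ∈ K, ∃ s ∈ curlyRange K,
      curlyWedge g (k * l) = curlyWedge g l * curlyWedge g k * s := by
    intro k hk l hl
    refine ⟨_, inv_mul_curlyConj_mem_curlyRange (hK (curlyComm_mem_commutator (curlyWedge g k)))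
      (inv_mem hl), ?_⟩
    rw [curlyWedge_mul_right', mul_assoc, mul_inv_cancel_left]
  have hn := curlyRange_normal K
  let S : Subgroup (CurlyWedge G) :=
    { carrier := {t | ∃ k ∈ K, ∃ s ∈ curlyRange K, t = curlyWedge g k * s}
      one_mem' := ⟨1, one_mem K, 1, one_mem _, by rw [curlyWedge_one_right, mul_one]⟩
      mul_mem' := by
        rintro _ _ ⟨k, hk, s, hs, rfl⟩ ⟨l, hl, u, hu, rfl⟩
        obtain ⟨v, hv, e⟩ := hmul l hl k hk
        refine ⟨l * k, mul_mem hl hk,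
          v⁻¹ * ((curlyWedge g l)⁻¹ * s * (curlyWedge g l)⁻¹⁻¹ * u),
          mul_mem (inv_mem hv) (mul_mem (hn.conj_mem s hs _) hu), ?_⟩
        rw [e]; group
      inv_mem' := by
        rintro _ ⟨k, hk, s, hs, rfl⟩
        obtain ⟨v, hv, e⟩ := hmul k hk k⁻¹ (inv_mem hk)
        rw [mul_inv_cancel, curlyWedge_one_right, eq_comm, mul_assoc] at e
        have e' : (curlyWedge g k)⁻¹ =
            curlyWedge g k⁻¹ * (curlyWedge g k * v * (curlyWedge g k)⁻¹) := by
          rw [← mul_assoc, e, one_mul]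
        refine ⟨k⁻¹, inv_mem hk,
          (curlyWedge g k * v * (curlyWedge g k)⁻¹) * (curlyWedge g k * s⁻¹ * (curlyWedge g k)⁻¹),
          mul_mem (hn.conj_mem _ hv _) (hn.conj_mem _ (inv_mem hs) _), ?_⟩
        rw [← mul_assoc, ← e']; group }
  have hle : curlyRange K ≤ S := fun s hs =>
    ⟨1, one_mem K, s, hs, by rw [curlyWedge_one_right, one_mul]⟩
  have hgk : ∀ k ∈ K, curlyWedge g k ∈ S := fun k hk =>
    ⟨k, hk, 1, one_mem _, by rw [mul_one]⟩
  have hinvg : ∀ h ∈ Subgroup.zpowers g, ∀ t ∈ S, curlyConj h t ∈ S := by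
    rintro h hh _ ⟨k, hk, s, hs, rfl⟩
    have hc : h * g * h⁻¹ = g := by
      obtain ⟨i, rfl⟩ := Subgroup.mem_zpowers_iff.1 hh
      group
    rw [map_mul, curlyConj_curlyWedge, hc]
    exact mul_mem (hgk _ (hKn.conj_mem k hk h)) (hle (curlyConj_mem_curlyRange_of_normal h hs))
  have hinv : ∀ h, ∀ t ∈ S, curlyConj h t ∈ S := by
    intro h t ht
    obtain ⟨k, hk, l, hl, rfl⟩ := Subgroup.mem_sup_of_normal_left.1 (hg ▸ Subgroup.mem_top h)
    rw [curlyConj_mul]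
    have h1 := hinvg l hl t ht
    have h2 := inv_mul_curlyConj_mem_curlyRange (hK (curlyComm_mem_commutator (curlyConj l t))) hk
    rw [← mul_inv_cancel_left (curlyConj l t) (curlyConj k _)]
    exact mul_mem h1 (hle h2)
  refine mem_of_curlyConj_invariant (S := S) hinv (X := K ∪ {g}) ?_ ?_ t
  · rw [Subgroup.closure_union, Subgroup.closure_eq, ← Subgroup.zpowers_eq_closure, hg]
  · rintro x (hx | rfl) y (hy | rfl)
    · exact hle (curlyWedge_mem_curlyRange hx hy)
    · rw [← curlyWedge_inv]
      exact inv_mem (hgk x hx)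
    · exact hgk y hy
    · rw [curlyWedge_self]
      exact one_mem S

/-- Write w = (g ⋏ k)s. As w is central and fixed by G, w^i is congruent to g^i ⋏ k modulo the image
of K ⋏ K. For i = n the latter wedge lies in that image, so w^n does too, and B₀(K) = 0 applies. -/
theorem pow_eq_one_of_cyclic_quotient (hB : bogomolovMultiplier K = ⊥) (hK : commutator G ≤ K)
    (hg : K ⊔ Subgroup.zpowers g = ⊤) {n : ℕ} (hn : g ^ n ∈ K) {w : CurlyWedge G}
    (hw : w ∈ bogomolovMultiplier G) : w ^ n = 1 := by
  obtain ⟨k, hk, s, hs, hws⟩ := exists_eq_curlyWedge_mul hK hg w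
  have hpow : ∀ i : ℕ, (w ^ i)⁻¹ * curlyWedge (g ^ i) k ∈ curlyRange K := by
    intro i
    induction i with
    | zero => simp [curlyWedge_one_left, one_mem]
    | succ i ih =>
      have h1 := curlyConj_mem_curlyRange_of_normal g⁻¹ ih
      rw [map_mul, map_inv, curlyConj_eq_self (pow_mem hw i)] at h1
      have h2 : (w ^ (i + 1))⁻¹ * curlyWedge (g ^ (i + 1)) k =
          w⁻¹ * ((w ^ i)⁻¹ * curlyConj g⁻¹ (curlyWedge (g ^ i) k)) * w⁻¹⁻¹ * s⁻¹ := by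
        have h3 : curlyWedge g k = w * s⁻¹ := by rw [hws, mul_inv_cancel_right]
        rw [pow_succ g, curlyWedge_mul_left', h3, pow_succ]; group
      rw [h2]
      exact mul_mem ((curlyRange_normal K).conj_mem _ h1 _) (inv_mem hs)
  refine eq_one_of_mem_curlyRange hB ?_ (pow_mem hw n)
  have h := mul_mem (curlyWedge_mem_curlyRange hn hk) (inv_mem (hpow n))
  rwa [mul_inv_rev, inv_inv, mul_inv_cancel_left] at h

end CyclicQuotient

/-! ### Transfer from (G ⋏ G) ⋊ P -/

section Transfer

variable {G : Type*} [Group G] (P : Subgroup G)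

/-- The conjugation action of `G` on `G ⋏ G` by automorphisms. -/
def curlyConjAut (G : Type*) [Group G] : G →* MulAut (CurlyWedge G) where
  toFun g := (curlyConj g).toMulEquiv (curlyConj g⁻¹)
    (MonoidHom.ext fun t => by simp [← curlyConj_mul])
    (MonoidHom.ext fun t => by simp [← curlyConj_mul])
  map_one' := MulEquiv.ext fun t => curlyConj_one t
  map_mul' g h := MulEquiv.ext fun t => curlyConj_mul g h t

/-- The semidirect product `(G ⋏ G) ⋊ P`. -/
abbrev CurlySemidirect : Type _ := CurlyWedge G ⋊[(curlyConjAut G).comp P.subtype] P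

/-- The homomorphism `(G ⋏ G) ⋊ P → G`, `(t, p) ↦ ∂t p`. -/
def curlySemidirectComm : CurlySemidirect P →* G :=
  SemidirectProduct.lift (curlyComm G) P.subtype
    (fun p => MonoidHom.ext fun t => curlyComm_curlyConj (p : G) t)

theorem curlySemidirectComm_apply (x : CurlySemidirect P) :
    curlySemidirectComm P x = curlyComm G x.left * x.right := rfl

theorem curlySemidirect_mul_left (x y : CurlySemidirect P) :
    (x * y).left = x.left * curlyConj (x.right : G) y.left := rfl

/-- The preimage of `P` under the commutator map. -/
abbrev curlyCommPreimage : Subgroup (CurlyWedge G) := P.comap (curlyComm G)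

instance curlyRange_subgroupOf_normal :
    ((curlyRange P).subgroupOf (curlyCommPreimage P)).Normal :=
  ⟨fun t ht s => by
    rw [Subgroup.mem_subgroupOf] at *
    have h := curlyConj_mem_curlyRange (H := P) (g := curlyComm G s.1)
      (fun x hx => mul_mem (mul_mem s.2 hx) (inv_mem s.2)) ht
    rwa [curlyConj_curlyComm] at h⟩

/-- The quotient of the preimage of `P` in `G ⋏ G` by the image of `P ⋏ P`. -/
abbrev CurlyCommQuotient : Type _ :=
  curlyCommPreimage P ⧸ (curlyRange P).subgroupOf (curlyCommPreimage P)

instance curlyCommQuotientCommGroup : CommGroup (CurlyCommQuotient P) :=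
  { (inferInstance : Group (CurlyCommQuotient P)) with
    mul_comm := by
      rintro ⟨s⟩ ⟨t⟩
      refine QuotientGroup.eq.2 ?_
      rw [Subgroup.mem_subgroupOf]
      have h := inv_mul_curlyConj_mem_curlyRange (K := P) t.2 (inv_mem s.2)
      rw [← map_inv, curlyConj_curlyComm] at h
      simpa only [Subgroup.coe_mul, Subgroup.coe_inv, mul_inv_rev, inv_inv, mul_assoc] using h }

theorem left_mem_curlyCommPreimage (x : P.comap (curlySemidirectComm P)) :
    x.1.left ∈ curlyCommPreimage P := by
  have h : curlyComm G x.1.left * x.1.right ∈ P := x.2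
  exact (Subgroup.mul_mem_cancel_right P x.1.right.2).1 h

/-- The homomorphism `(t, p) ↦ t` from the preimage of `P` in `(G ⋏ G) ⋊ P`. -/
def curlySemidirectLeft : P.comap (curlySemidirectComm P) →* CurlyCommQuotient P where
  toFun x := QuotientGroup.mk ⟨x.1.left, left_mem_curlyCommPreimage P x⟩
  map_one' := rfl
  map_mul' x y := by
    refine QuotientGroup.eq.2 ?_
    rw [Subgroup.mem_subgroupOf]
    have h := inv_mem (inv_mul_curlyConj_mem_curlyRange (left_mem_curlyCommPreimage P y)
      x.1.right.2)
    simpa only [Subgroup.coe_mul, Subgroup.coe_inv, curlySemidirect_mul_left, mul_inv_rev, inv_inv,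
      mul_assoc, inv_mul_cancel_left] using h

theorem curlySemidirectLeft_eq_one_iff (x : P.comap (curlySemidirectComm P)) :
    curlySemidirectLeft P x = 1 ↔ x.1.left ∈ curlyRange P :=
  (QuotientGroup.eq_one_iff _).trans Subgroup.mem_subgroupOf

theorem curlyConj_mem_curlyRange_of_mem {p : G} (hp : p ∈ P) {t : CurlyWedge G}
    (ht : t ∈ curlyRange P) : curlyConj p t ∈ curlyRange P :=
  curlyConj_mem_curlyRange (fun _ hx => mul_mem (mul_mem hp hx) (inv_mem hp)) ht

/-- The elements `(t, (∂t)⁻¹)` of `(G ⋏ G) ⋊ P` with `t` in the image of `P ⋏ P`. -/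
def curlyAntidiagonal : Subgroup (CurlySemidirect P) where
  carrier := {x | x.left ∈ curlyRange P ∧ curlySemidirectComm P x = 1}
  one_mem' := ⟨one_mem _, map_one _⟩
  mul_mem' {x y} hx hy := ⟨mul_mem hx.1 (curlyConj_mem_curlyRange_of_mem P x.right.2 hy.1), by
    rw [map_mul, hx.2, hy.2, mul_one]⟩
  inv_mem' {x} hx := ⟨curlyConj_mem_curlyRange_of_mem P (inv_mem x.right.2) (inv_mem hx.1), by
    rw [map_inv, hx.2, inv_one]⟩

/-- The P-component of x is ∂(`x.left`)⁻¹, so by the Peiffer identity it cancels conjugation by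
`x.left`. -/
theorem inl_mul_of_mem_curlyAntidiagonal {x : CurlySemidirect P} (hx : x ∈ curlyAntidiagonal P)
    (t : CurlyWedge G) : SemidirectProduct.inl t * x = x * SemidirectProduct.inl t := by
  have hr : (x.right : G) = curlyComm G x.left⁻¹ := by
    rw [map_inv]
    exact (inv_eq_of_mul_eq_one_right hx.2).symm
  refine SemidirectProduct.ext ?_ (by simp)
  rw [curlySemidirect_mul_left, curlySemidirect_mul_left, hr, curlyConj_curlyComm]
  simp [mul_assoc]

instance curlyAntidiagonal_normal : (curlyAntidiagonal P).Normal := by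
  refine ⟨fun x hx y => ?_⟩
  -- The factor G ⋏ G centralizes the antidiagonal, so only conjugation by P matters.
  have hb : SemidirectProduct.inr y.right * x * (SemidirectProduct.inr y.right)⁻¹ ∈
      curlyAntidiagonal P := by
    refine ⟨?_, by rw [map_mul, map_mul, hx.2, map_inv]; group⟩
    have h := curlyConj_mem_curlyRange_of_mem P y.right.2 hx.1
    rw [← map_inv, curlySemidirect_mul_left, curlySemidirect_mul_left]
    simpa using h
  have h := inl_mul_of_mem_curlyAntidiagonal P hb y.left
  have e : y * x * y⁻¹ =
      SemidirectProduct.inr y.right * x * (SemidirectProduct.inr y.right)⁻¹ := by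
    conv_lhs => rw [← SemidirectProduct.inl_left_mul_inr_right y]
    rw [← mul_inv_eq_iff_eq_mul] at h
    simpa only [mul_assoc, mul_inv_rev] using h
  rwa [e]

variable [P.FiniteIndex]

instance finiteIndex_comap_curlySemidirectComm : (P.comap (curlySemidirectComm P)).FiniteIndex :=
  ⟨by
    rw [Subgroup.index_comap]
    exact Subgroup.FiniteIndex.index_ne_zero (H := P.subgroupOf (curlySemidirectComm P).range)⟩

/-- The transfer `(G ⋏ G) ⋊ P → Q / T`, where `Q` is the preimage of `P` in `G ⋏ G` and `T` is the
image of `P ⋏ P`. -/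
noncomputable def curlyTransfer : CurlySemidirect P →* CurlyCommQuotient P :=
  (curlySemidirectLeft P).transfer

/-- The transfer is a product of values at conjugates of powers of x. By normality these stay in the
antidiagonal, where the left component is in the image of P ⋏ P. -/
theorem curlyTransfer_eq_one_of_mem_curlyAntidiagonal {x : CurlySemidirect P}
    (hx : x ∈ curlyAntidiagonal P) : curlyTransfer P x = 1 := by
  classical
  have := Fintype.ofFinite (MulAction.orbitRel.Quotient (Subgroup.zpowers x)
    (CurlySemidirect P ⧸ P.comap (curlySemidirectComm P)))
  rw [curlyTransfer, MonoidHom.transfer_eq_prod_quotient_orbitRel_zpowers_quot]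
  refine Finset.prod_eq_one fun q _ => (curlySemidirectLeft_eq_one_iff P _).2 ?_
  have h := (curlyAntidiagonal_normal P).conj_mem _
    (pow_mem hx (Function.minimalPeriod (x • ·) q.out)) q.out.out⁻¹
  rw [inv_inv] at h
  exact h.1

theorem map_conj_of_commGroup {L A : Type*} [Group L] [CommGroup A] (f : L →* A) (x y : L) :
    f (x * y * x⁻¹) = f y := by
  rw [map_mul, map_mul, map_inv, mul_right_comm, mul_inv_cancel, one_mul]

/-- Since G = G'P and ∂ maps onto G', conjugation by any g is induced by an inner automorphism of
the semidirect product, invisible in an abelian target. -/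
theorem curlyTransfer_inl_conj (hP : commutator G ⊔ P = ⊤) (g : G) (t : CurlyWedge G) :
    curlyTransfer P (SemidirectProduct.inl (curlyConj g t)) =
      curlyTransfer P (SemidirectProduct.inl t) := by
  obtain ⟨x, hx, p, hp, rfl⟩ := Subgroup.mem_sup_of_normal_left.1 (hP ▸ Subgroup.mem_top g)
  obtain ⟨s, rfl⟩ := exists_curlyComm_eq hx
  let f : CurlyWedge G →* CurlyCommQuotient P := (curlyTransfer P).comp SemidirectProduct.inl
  have e : f (curlyConj p t) = f t := by
    have h : SemidirectProduct.inl (curlyConj p t) = _ :=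
      SemidirectProduct.inl_aut (φ := (curlyConjAut G).comp P.subtype) ⟨p, hp⟩ t
    have h' := congrArg (curlyTransfer P) h
    rw [map_inv] at h'
    exact h'.trans (map_conj_of_commGroup (curlyTransfer P) _ _)
  change f _ = f t
  rw [curlyConj_mul, curlyConj_curlyComm, map_conj_of_commGroup, e]

/-- For x = ∂s in G', x ⋏ y is s⁻¹ times a conjugate of s, killed by invariance. For x, y ∈ P, x ⋏ y
agrees modulo the antidiagonal with the commutator [x, y] in P, killed because the target is
abelian. -/
theorem curlyTransfer_inl_eq_one (hP : commutator G ⊔ P = ⊤) (t : CurlyWedge G) :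
    curlyTransfer P (SemidirectProduct.inl t) = 1 := by
  let S : Subgroup (CurlyWedge G) := ((curlyTransfer P).comp SemidirectProduct.inl).ker
  have hS : ∀ t, t ∈ S ↔ curlyTransfer P (SemidirectProduct.inl t) = 1 := fun t => Iff.rfl
  have hcomm : ∀ x ∈ commutator G, ∀ y, curlyWedge x y ∈ S := by
    intro x hx y
    obtain ⟨s, rfl⟩ := exists_curlyComm_eq hx
    have h := curlyConj_inv_eq_mul y s
    rw [← inv_mul_eq_iff_eq_mul] at h
    rw [hS, ← h, map_mul, map_mul, curlyTransfer_inl_conj P hP, ← map_mul, ← map_mul,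
      inv_mul_cancel, map_one, map_one]
  refine mem_of_curlyConj_invariant (S := S) (fun g t ht => ?_) (X := commutator G ∪ P) ?_ ?_ t
  · rw [hS, curlyTransfer_inl_conj P hP]
    exact ht
  · rw [Subgroup.closure_union, Subgroup.closure_eq, Subgroup.closure_eq, hP]
  · rintro x (hx | hx) y (hy | hy)
    · exact hcomm x hx y
    · exact hcomm x hx y
    · rw [← curlyWedge_inv]
      exact inv_mem (hcomm y hy x)
    · rw [hS]
      have h1 : curlyTransfer P (SemidirectProduct.inr (rcomm (⟨x, hx⟩ : P) ⟨y, hy⟩)) = 1 := by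
        have h := map_rcomm ((curlyTransfer P).comp SemidirectProduct.inr) (⟨x, hx⟩ : P) ⟨y, hy⟩
        rw [MonoidHom.comp_apply] at h
        rw [h, rcomm_eq_one_iff, mul_comm]
      have h2 : SemidirectProduct.inl (curlyWedge x y) *
          (SemidirectProduct.inr (rcomm (⟨x, hx⟩ : P) ⟨y, hy⟩))⁻¹ ∈ curlyAntidiagonal P := by
        refine ⟨?_, ?_⟩
        · rw [← map_inv, curlySemidirect_mul_left]
          simpa using curlyWedge_mem_curlyRange hx hy
        · rw [← map_inv, curlySemidirectComm_apply, curlySemidirect_mul_left]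
          simp only [SemidirectProduct.left_inl, SemidirectProduct.left_inr, map_one, mul_one,
            SemidirectProduct.mul_right, SemidirectProduct.right_inl, SemidirectProduct.right_inr,
            one_mul, curlyComm_curlyWedge]
          exact mul_inv_cancel (rcomm x y)
      have h3 := curlyTransfer_eq_one_of_mem_curlyAntidiagonal P h2
      rwa [map_mul, map_inv, h1, inv_one, mul_one] at h3

/-- The element w is central in the semidirect product, so its transfer is the class of w^[G : P].
The transfer being trivial, this power lies in the image of P ⋏ P, where B₀(P) = 0 forces it to be
1. -/
theorem pow_index_eq_one_of_commutator_sup_eq_top (hB : bogomolovMultiplier P = ⊥)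
    (hP : commutator G ⊔ P = ⊤) {w : CurlyWedge G} (hw : w ∈ bogomolovMultiplier G) :
    w ^ P.index = 1 := by
  have hsurj : Function.Surjective (curlySemidirectComm P) := fun g => by
    obtain ⟨x, hx, p, hp, rfl⟩ := Subgroup.mem_sup_of_normal_left.1 (hP ▸ Subgroup.mem_top g)
    obtain ⟨s, rfl⟩ := exists_curlyComm_eq hx
    exact ⟨⟨s, ⟨p, hp⟩⟩, rfl⟩
  have hcentral : ∀ k : ℕ, ∀ x : CurlySemidirect P,
      x⁻¹ * SemidirectProduct.inl w ^ k * x = SemidirectProduct.inl w ^ k := by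
    intro k x
    have hk : w ^ k ∈ bogomolovMultiplier G := pow_mem hw k
    rw [mul_assoc, inv_mul_eq_iff_eq_mul, ← map_pow]
    refine SemidirectProduct.ext ?_ (by simp only [SemidirectProduct.mul_right,
      SemidirectProduct.right_inl, one_mul, mul_one])
    rw [curlySemidirect_mul_left, curlySemidirect_mul_left]
    simp [-map_pow, curlyConj_eq_self hk, mul_comm_of_mem_bogomolovMultiplier hk]
  have h := curlyTransfer_inl_eq_one P hP w
  rw [curlyTransfer, MonoidHom.transfer_eq_pow _ _ (fun k x _ => hcentral k x),
    curlySemidirectLeft_eq_one_iff] at h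
  simp only [← map_pow, SemidirectProduct.left_inl] at h
  rw [Subgroup.index_comap_of_surjective P hsurj] at h
  exact eq_one_of_mem_curlyRange hB h (pow_mem hw _)

end Transfer

/-! ### Reduction to p-groups -/

section PGroup

variable {G : Type*} [Group G] [Finite G]

theorem IsB0Minimal.exists_pow_eq_one (hG : IsB0Minimal G) {p : ℕ} [hp : Fact p.Prime]
    (hGp : ¬ IsPGroup p G) {w : CurlyWedge G} (hw : w ∈ bogomolovMultiplier G) :
    ∃ n : ℕ, ¬ p ∣ n ∧ w ^ n = 1 := by
  let P : Sylow p G := default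
  have hPtop : (P : Subgroup G) ≠ ⊤ := fun h => hGp fun g => by
    obtain ⟨k, hk⟩ := P.isPGroup' ⟨g, by rw [h]; trivial⟩
    exact ⟨k, congrArg Subtype.val hk⟩
  rcases IsCoatomic.eq_top_or_exists_le_coatom (commutator G ⊔ (P : Subgroup G)) with
    h | ⟨K, hK, hle⟩
  · exact ⟨_, P.not_dvd_index,
      pow_index_eq_one_of_commutator_sup_eq_top (P : Subgroup G) (hG.subgroup _ hPtop) h hw⟩
  · have hcK : commutator G ≤ K := le_sup_left.trans hle
    have hKn : K.Normal := Subgroup.Normal.of_commutator_le G hcK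
    obtain ⟨g, hg⟩ : ∃ g, g ∉ K := by
      by_contra! h
      exact hK.1 (eq_top_iff.2 fun g _ => h g)
    -- Since P ≤ K, the index of K divides that of P and is prime to p.
    refine ⟨K.index, fun h => P.not_dvd_index
      (h.trans (Subgroup.index_dvd_of_le (le_sup_right.trans hle))),
      pow_eq_one_of_cyclic_quotient (g := g) (hG.subgroup K hK.1) hcK
        (hK.2 _ (lt_of_le_of_ne le_sup_left fun h => hg ?_)) (K.pow_index_mem g) hw⟩
    rw [h]
    exact (le_sup_right : Subgroup.zpowers g ≤ _) (Subgroup.mem_zpowers g)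

/-- A `B₀`-minimal group is a `p`-group. -/
theorem IsB0Minimal.exists_isPGroup (hG : IsB0Minimal G) : ∃ p, p.Prime ∧ IsPGroup p G := by
  by_contra! hne
  refine hG.ne_bot (eq_bot_iff.2 fun w hw => ?_)
  rw [Subgroup.mem_bot, ← orderOf_eq_one_iff]
  by_contra h
  -- Infinite order needs no separate case: then `orderOf w` is 0, its `minFac` is 2, and n must be
  -- 0, which 2 divides.
  have hp := Nat.minFac_prime h
  have : Fact (orderOf w).minFac.Prime := ⟨hp⟩
  obtain ⟨n, hn, hwn⟩ := hG.exists_pow_eq_one (hne _ hp) hw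
  exact hn ((Nat.minFac_dvd _).trans (orderOf_dvd_of_pow_eq_one hwn))

end PGroup

open scoped commutatorElement

/-! ### Commutators, the Frattini subgroup and central elements -/

section CommutatorCriteria

variable {G : Type*} [Group G]

/-- If the quotient by `N` of a group generated by `X` has commuting generators, it is abelian. -/
theorem rcomm_mem_of_closure_eq_top {N : Subgroup G} [hN : N.Normal] {X : Set G}
    (hX : Subgroup.closure X = ⊤) (h : ∀ x ∈ X, ∀ y ∈ X, rcomm x y ∈ N) (x y : G) :
    rcomm x y ∈ N := by
  have := mem_of_curlyConj_invariant (S := N.comap (curlyComm G)) (fun g t ht => by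
      rw [Subgroup.mem_comap, curlyComm_curlyConj]
      exact hN.conj_mem _ ht g) hX (fun x hx y hy => by
      rw [Subgroup.mem_comap, curlyComm_curlyWedge]
      exact h x hx y hy) (curlyWedge x y)
  rwa [Subgroup.mem_comap, curlyComm_curlyWedge] at this

theorem commutator_le_of_rcomm_mem {N : Subgroup G} (h : ∀ x y : G, rcomm x y ∈ N) :
    commutator G ≤ N :=
  Subgroup.commutator_le.2 fun x _ y _ => by
    simpa [rcomm, commutatorElement_def] using h x⁻¹ y⁻¹

theorem commutator_le_of_sup_zpowers_eq_top {K : Subgroup G} [K.Normal] {g : G}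
    (hg : K ⊔ Subgroup.zpowers g = ⊤) : commutator G ≤ K := by
  refine commutator_le_of_rcomm_mem (rcomm_mem_of_closure_eq_top (X := K ∪ {g}) ?_ ?_)
  · rw [Subgroup.closure_union, Subgroup.closure_eq, ← Subgroup.zpowers_eq_closure, hg]
  · rintro x (hx | rfl) y (hy | rfl)
    · exact rcomm_mem_of_left hx y
    · exact rcomm_mem_of_left hx y
    · exact rcomm_mem_of_right hy x
    · simp [rcomm, one_mem]

theorem commutator_le_frattini [Finite G] [hG : Group.IsNilpotent G] :
    commutator G ≤ frattini G := by
  refine le_iInf₂ fun K hK => ?_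
  have hKn : K.Normal :=
    Subgroup.NormalizerCondition.normal_of_coatom K Group.normalizerCondition_of_isNilpotent hK
  obtain ⟨g, hg⟩ : ∃ g, g ∉ K := by
    by_contra! h
    exact hK.1 (eq_top_iff.2 fun g _ => h g)
  refine commutator_le_of_sup_zpowers_eq_top (g := g)
    (hK.2 _ (lt_of_le_of_ne le_sup_left fun h => hg ?_))
  rw [h]
  exact (le_sup_right : Subgroup.zpowers g ≤ _) (Subgroup.mem_zpowers g)

theorem isCoatom_of_index_prime {H : Subgroup G} (hH : H.index.Prime) : IsCoatom H := by
  refine ⟨fun h => hH.one_lt.ne' (Subgroup.index_eq_one.2 h), fun K hK => ?_⟩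
  have h := Subgroup.relIndex_mul_index hK.le
  rcases (Nat.dvd_prime hH).1 (Dvd.intro_left _ h) with h1 | h1
  · exact Subgroup.index_eq_one.1 h1
  · rw [h1] at h
    have h2 : H.relIndex K = 1 := (Nat.mul_eq_right hH.ne_zero).1 h
    exact absurd (Subgroup.relIndex_eq_one.1 h2) hK.not_ge

/-- If all commutators lie in a central subgroup of prime order, the Frattini subgroup is
central. -/
theorem frattini_le_center_of_rcomm_mem_zpowers {z : G} (hz : z ∈ Subgroup.center G)
    (hzp : (orderOf z).Prime) (h : ∀ x y : G, rcomm x y ∈ Subgroup.zpowers z) :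
    frattini G ≤ Subgroup.center G := by
  intro x hx
  rw [Subgroup.mem_center_iff]
  intro y
  have hc : ∀ g h' : G, h' * rcomm g y = rcomm g y * h' := fun g h' =>
    Subgroup.mem_center_iff.1 (Subgroup.zpowers_le.2 hz (h g y)) h'
  -- Commutators are central, so g ↦ [g, y] is a homomorphism into ⟨z⟩; its kernel has index 1 or
  -- the prime order of z, and so contains the Frattini subgroup.
  let f : G →* G := MonoidHom.mk' (fun g => rcomm g y) fun a b => by
    have e : rcomm (a * b) y = b⁻¹ * rcomm a y * b * rcomm b y := by simp only [rcomm]; group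
    rw [e, hc a b⁻¹, inv_mul_cancel_right]
  have hf : f.ker.index ∣ orderOf z := by
    rw [Subgroup.index_ker, ← Nat.card_zpowers]
    refine Subgroup.card_dvd_of_le ?_
    rintro _ ⟨g, rfl⟩
    exact h g y
  have hxf : x ∈ f.ker := by
    rcases (Nat.dvd_prime hzp).1 hf with h1 | h1
    · rw [Subgroup.index_eq_one.1 h1]; trivial
    · exact frattini_le_coatom (isCoatom_of_index_prime (h1 ▸ hzp)) hx
  exact ((rcomm_eq_one_iff x y).1 hxf).symm

/-- A nontrivial normal subgroup of a finite `p`-group contains a central element of order `p`. -/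
theorem IsPGroup.exists_mem_center_orderOf_eq [Finite G] {p : ℕ} [hp : Fact p.Prime]
    (hG : IsPGroup p G) {N : Subgroup G} [N.Normal] (hN : N ≠ ⊥) :
    ∃ z ∈ N, z ∈ Subgroup.center G ∧ orderOf z = p := by
  have hdvd : ∀ H : Subgroup G, H ≠ ⊥ → p ∣ Nat.card H := fun H hH => by
    have : Nontrivial H := (Subgroup.nontrivial_iff_ne_bot H).2 hH
    obtain ⟨n, hn, h⟩ := (IsPGroup.nontrivial_iff_card (hG.to_subgroup H)).1 this
    rw [h]
    exact dvd_pow_self p hn.ne'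
  have hne : N ⊓ Subgroup.center G ≠ ⊥ := by
    -- The number of points of N fixed under conjugation is divisible by p, and 1 is one of them, so
    -- there is another.
    obtain ⟨b, hb, hb1⟩ := (hG.of_equiv ConjAct.toConjAct)
      |>.exists_fixed_point_of_prime_dvd_card_of_fixed_point N (hdvd N hN) (a := 1)
      (fun g => by simp)
    have hbc : (b : G) ∈ Subgroup.center G := by
      rw [Subgroup.mem_center_iff]
      intro g
      have := congrArg Subtype.val (hb (ConjAct.toConjAct g))
      rw [ConjAct.Subgroup.val_conj_smul, ConjAct.toConjAct_smul] at this
      exact mul_inv_eq_iff_eq_mul.1 this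
    intro h
    have : (b : G) ∈ N ⊓ Subgroup.center G := ⟨b.2, hbc⟩
    rw [h, Subgroup.mem_bot] at this
    exact hb1 (Subtype.ext this.symm)
  obtain ⟨z, hz⟩ := exists_prime_orderOf_dvd_card' p (hdvd _ hne)
  exact ⟨z, z.2.1, z.2.2, by rw [Subgroup.orderOf_coe, hz]⟩

end CommutatorCriteria

/-! ### The Frattini subgroup and the number of generators -/

section MainTheorem

variable {G : Type*} [Group G] [Finite G]

theorem IsB0Minimal.frattini_comm (hG : IsB0Minimal G) :
    ∀ x ∈ frattini G, ∀ y ∈ frattini G, x * y = y * x := by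
  obtain ⟨p, hp, hGp⟩ := hG.exists_isPGroup
  have : Fact p.Prime := ⟨hp⟩
  by_cases hΦ : ⁅frattini G, frattini G⁆ = ⊥
  · intro x hx y hy
    have h := Subgroup.commutator_mem_commutator hx hy
    rw [hΦ, Subgroup.mem_bot] at h
    exact commutatorElement_eq_one_iff_mul_comm.1 h
  · obtain ⟨z, hzN, hzc, hzp⟩ := hGp.exists_mem_center_orderOf_eq hΦ
    have hz1 : z ≠ 1 := fun h => hp.one_lt.ne (by rw [← hzp, h, orderOf_one])
    obtain ⟨a, b, hab, htop⟩ := hG.exists_sup_closure_eq_top hzc hz1 hzN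
    rw [sup_comm] at htop
    have hN : (Subgroup.zpowers z).Normal := ⟨fun n hn g => by
      rwa [Subgroup.mem_center_iff.1 (Subgroup.zpowers_le.2 hzc hn) g, mul_inv_cancel_right]⟩
    have hba : rcomm b a ∈ Subgroup.zpowers z := by
      have e : rcomm b a = (rcomm a b)⁻¹ := by simp only [rcomm]; group
      rw [e]
      exact inv_mem hab
    have hself : ∀ x : G, rcomm x x ∈ Subgroup.zpowers z := fun x => by simp [rcomm, one_mem]
    have hcomm := rcomm_mem_of_closure_eq_top (N := Subgroup.zpowers z)
      (frattini_nongenerating htop) (by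
        rintro x (rfl | rfl) y (rfl | rfl)
        exacts [hself _, hab, hba, hself _])
    intro x _ y hy
    exact Subgroup.mem_center_iff.1
      (frattini_le_center_of_rcomm_mem_zpowers hzc (hzp ▸ hp) hcomm hy) x

theorem IsB0Minimal.commutator_ne_bot (hG : IsB0Minimal G) : commutator G ≠ ⊥ := by
  refine fun h => hG.ne_bot (eq_bot_iff.2 fun w _ => ?_)
  refine mem_of_curlyWedge_mem (fun x y => ?_) w
  have hxy := curlyComm_mem_commutator (curlyWedge x y)
  rw [h, Subgroup.mem_bot, curlyComm_curlyWedge] at hxy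
  exact curlyWedge_eq_one hxy

/-- In a nilpotent group of class `m + 2` some central commutator `[x, y] ≠ 1` has `x` in the
`m`-th term of the lower central series. -/
theorem exists_commutator_mem_center {H : Type*} [Group H] [Group.IsNilpotent H] {m : ℕ}
    (hm : Group.nilpotencyClass H = m + 2) :
    ∃ x ∈ (⊤ : Subgroup H).lowerCentralSeries m, ∃ y : H,
      ⁅x, y⁆ ≠ 1 ∧ ⁅x, y⁆ ∈ Subgroup.center H := by
  have hbot : (⊤ : Subgroup H).lowerCentralSeries (m + 2) = ⊥ :=
    hm ▸ Subgroup.lowerCentralSeries_nilpotencyClass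
  have hne : (⊤ : Subgroup H).lowerCentralSeries (m + 1) ≠ ⊥ := fun h => by
    have := Subgroup.lowerCentralSeries_eq_bot_iff_nilpotencyClass_le.1 h
    omega
  rw [Subgroup.lowerCentralSeries_succ] at hne
  obtain ⟨x, hx, y, hxy⟩ : ∃ x ∈ (⊤ : Subgroup H).lowerCentralSeries m, ∃ y : H, ⁅x, y⁆ ≠ 1 := by
    by_contra! h
    exact hne (eq_bot_iff.2 (Subgroup.commutator_le.2 fun x hx y _ => h x hx y))
  refine ⟨x, hx, y, hxy, Subgroup.mem_center_iff.2 fun g => ?_⟩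
  have h := Subgroup.commutator_mem_commutator
    (Subgroup.commutator_mem_commutator hx (Subgroup.mem_top y)) (Subgroup.mem_top g)
  rw [← Subgroup.lowerCentralSeries_succ, ← Subgroup.lowerCentralSeries_succ, hbot,
    Subgroup.mem_bot] at h
  exact (commutatorElement_eq_one_iff_mul_comm.1 h).symm

theorem IsB0Minimal.exists_generators (hG : IsB0Minimal G) :
    ∃ x y a b : G, Subgroup.closure {x, y, a, b} = ⊤ ∧
      (3 ≤ Group.nilpotencyClass G → x ∈ commutator G) := by
  obtain ⟨p, hp, hGp⟩ := hG.exists_isPGroup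
  have : Fact p.Prime := ⟨hp⟩
  have hnil : Group.IsNilpotent G := hGp.isNilpotent
  have hclass : 2 ≤ Group.nilpotencyClass G := by
    by_contra! h
    exact hG.commutator_ne_bot ((Subgroup.lowerCentralSeries_eq_bot_iff_nilpotencyClass_le
      (n := 1)).2 (by omega))
  obtain ⟨m, hm⟩ := Nat.exists_eq_add_of_le' hclass
  obtain ⟨x, hx, y, hxy, hc⟩ := exists_commutator_mem_center hm
  obtain ⟨a, b, -, htop⟩ := hG.exists_sup_closure_eq_top (S := Subgroup.closure {x, y}) hc hxy
    (Subgroup.commutator_mem_commutator (Subgroup.subset_closure (by simp))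
      (Subgroup.subset_closure (by simp)))
  refine ⟨x, y, a, b, ?_, fun h3 => ?_⟩
  · rw [← htop, ← Subgroup.closure_union, Set.insert_union, Set.singleton_union]
  -- The series is indexed from 0, so term 1 is G'; class m + 2 ≥ 3 gives m ≥ 1.
  · exact Subgroup.lowerCentralSeries_antitone ⊤ (show 1 ≤ m by omega) hx

end MainTheorem

theorem theorem2p6 (G : Type*) [Group G] [Finite G] (hG : IsB0Minimal G) :
    (∀ x ∈ frattini G, ∀ y ∈ frattini G, x * y = y * x) ∧
      Group.rank G ≤ 4 ∧
      (3 ≤ Group.nilpotencyClass G → Group.rank G ≤ 3) := by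
  classical
  obtain ⟨x, y, a, b, htop, hx⟩ := hG.exists_generators
  refine ⟨hG.frattini_comm, ?_, fun h3 => ?_⟩
  · exact (Group.rank_le (S := {x, y, a, b}) (by push_cast; exact htop)).trans Finset.card_le_four
  · obtain ⟨p, hp, hGp⟩ := hG.exists_isPGroup
    have : Fact p.Prime := ⟨hp⟩
    have hnil : Group.IsNilpotent G := hGp.isNilpotent
    have hgen : Subgroup.closure {y, a, b} = (⊤ : Subgroup G) := by
      refine frattini_nongenerating (eq_top_iff.2 ?_)
      rw [← htop, Subgroup.closure_le, Set.insert_subset_iff]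
      exact ⟨(le_sup_right : frattini G ≤ _) (commutator_le_frattini (hx h3)),
        Subgroup.subset_closure.trans (le_sup_left : Subgroup.closure {y, a, b} ≤ _)⟩
    exact (Group.rank_le (S := {y, a, b}) (by push_cast; exact hgen)).trans Finset.card_le_three
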